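/- A cone in $\mathbb{R}^2$ is a set $\{u : |u\cdot v|\ge \ell\|u\|\}$ with $v$ a unit vector (spanning its axis) and $\ell\in(0,1)$. A cone field is an assignment of a cone to each point of $\mathbb{R}^2$, with $v$ and $\ell$ depending continuously on the point. Let $F_1,F_2:\mathbb{R}^2\to\mathbb{R}^2$ be $C^1$ diffeomorphisms (onto $\mathbb{R}^2$) that are synchronously hyperbolic: they are both orientation preserving or both orientation reversing, and there are $\lambda>1$, cones $K^u,K^s$ with $K^u\cap K^s=\{0\}$ whose axes are the $x$-axis and the $y$-axis respectively, and cone fields $(K^u_P)$, $(K^s_P)$ such that for all $P\in\mathbb{R}^2$ and $i=1,2$: (S1) $K^u_P\subset K^u$, $K^s_P\subset K^s$, $D(F_i)_P(K^u_P)\subset K^u_{F_i(P)}$ and $D(F_i^{-1})_P(K^s_P)\subset K^s_{F_i^{-1}(P)}$; (S2) $\|D(F_i)_P u\|\ge\lambda\|u\|$ for $u\in K^u_P$ and $\|D(F_i^{-1})_P w\|\ge\lambda\|w\|$ for $w\in K^s_P$; (S3) there is a curve $\Gamma=\{(g(y),y): y\in\mathbb{R}\}$ (the divider), with $g:\mathbb{R}\to\mathbb{R}$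 of class $C^1$, such that for every $P\in\Gamma$ we have $F_1(P)=F_2(P)$, the vectors tangent to $\Gamma$ at $P$ lie in $K^s_P$, and the vectors tangent to $F_i(\Gamma)$ at $F_i(P)$ lie in $K^u_{F_i(P)}$. Let the closed left and right half-planes be $\{x\le g(y)\}$ and $\{x\ge g(y)\}$, and let $F$ be equal to $F_1$ on the left half-plane and to $F_2$ on the right one; $F$ is a bijection of $\mathbb{R}^2$. Suppose that $F$ is Lozi-like, that is, $-1<\det D(F_i)_P<0$ for all $P$ and $i=1,2$, and there is a nonempty set $\Delta$, homeomorphic to an open disk and with closure homeomorphic to a closed disk, such that $F(\overline\Delta)\subset\operatorname{int}\Delta$. Put $\Lambda=\bigcap_{n\ge0}F^n(\Delta)$. A sequence $\bar p=(p_n)_{n\in\mathbb{Z}}\in\{-,+\}^{\mathbb{Z}}$ is an itinerary of $P\in\Lambda$ if, for every $n\in\mathbb{Z}$, the point $F^n(P)$ lies in the closed left half-plane when $p_n=-$ and in the closed right half-plane when $p_n=+$. Let $\Sigma_\Lambda$ be the set of all itineraries of points of $\Lambda$, with the topology induced by the product topology of $\{-,+\}^{\mathbb{Z}}$. Then every $\bar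 p\in\Sigma_\Lambda$ is an itinerary of exactly one point $\pi(\bar p)\in\Lambda$, and the map $\pi:\Sigma_\Lambda\to\Lambda$ so defined is surjective and continuous. -/

import Mathlib

open Set Topology
open scoped Manifold ContDiff

/-- The Euclidean plane. The coordinates of a point `P` are `P 0` and `P 1`. -/
abbrev Plane : Type := EuclideanSpace ℝ (Fin 2)

/-- The `C¹` diffeomorphisms of the plane onto itself. -/
abbrev PlaneDiffeo : Type := Diffeomorph 𝓘(ℝ, Plane) 𝓘(ℝ, Plane) Plane Plane 1

/-- The set of vectors `u` with `|u · v| ≥ ℓ ‖u‖`. It is the cone with axis `v` and coefficient `ℓ`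
when `v` is a unit vector and `0 < ℓ < 1`. -/
def cone (v : Plane) (ℓ : ℝ) : Set Plane := {u | ℓ * ‖u‖ ≤ |inner ℝ u v|}

/-- Two cones are universal if they meet only in the zero vector, the axis of `Ku` is the `x`-axis
and the axis of `Ks` is the `y`-axis. -/
def IsUniversalPair (Ku Ks : Set Plane) : Prop :=
  (∃ ℓ ∈ Ioo (0 : ℝ) 1, Ku = cone !₂[1, 0] ℓ) ∧
  (∃ ℓ ∈ Ioo (0 : ℝ) 1, Ks = cone !₂[0, 1] ℓ) ∧
  Ku ∩ Ks = {0}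

/-- A continuous field of cones on the plane. -/
structure ConeField where
  axis : Plane → Plane
  coeff : Plane → ℝ
  norm_axis : ∀ P, ‖axis P‖ = 1
  coeff_mem : ∀ P, coeff P ∈ Ioo (0 : ℝ) 1
  continuous_axis : Continuous axis
  continuous_coeff : Continuous coeff

/-- The cone of the field at the point `P`. -/
def ConeField.coneAt (C : ConeField) (P : Plane) : Set Plane := cone (C.axis P) (C.coeff P)

/-- `F₁` and `F₂` are both orientation preserving or both orientation reversing. -/
def SameOrientation (F₁ F₂ : PlaneDiffeo) : Prop :=
  (∀ P, 0 < (fderiv ℝ F₁ P).det ∧ 0 < (fderiv ℝ F₂ P).det) ∨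
  (∀ P, (fderiv ℝ F₁ P).det < 0 ∧ (fderiv ℝ F₂ P).det < 0)

/-- `F` maps the unstable cones into unstable cones, and `F⁻¹` maps the stable cones into stable
cones. -/
def PreservesCones (F : PlaneDiffeo) (Cu Cs : ConeField) : Prop :=
  ∀ P, MapsTo (fderiv ℝ F P) (Cu.coneAt P) (Cu.coneAt (F P)) ∧
    MapsTo (fderiv ℝ F.symm P) (Cs.coneAt P) (Cs.coneAt (F.symm P))

/-- `DF` expands the vectors of the unstable cones, and `DF⁻¹` expands the vectors of the stable
cones, at least by the factor `r`. -/
def ExpandsCones (F : PlaneDiffeo) (Cu Cs : ConeField) (r : ℝ) : Prop :=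
  ∀ P, (∀ u ∈ Cu.coneAt P, r * ‖u‖ ≤ ‖fderiv ℝ F P u‖) ∧
    (∀ w ∈ Cs.coneAt P, r * ‖w‖ ≤ ‖fderiv ℝ F.symm P w‖)

/-- The curve `x = g y`, where `y` runs through all real numbers. -/
def graphCurve (g : ℝ → ℝ) (y : ℝ) : Plane := !₂[g y, y]

/-- The curve `x = g y` is a divider: it is of class `C¹`, the two maps agree on it, the vectors
tangent to it lie in the stable cones, and the vectors tangent to its image lie in the unstable
cones. It is infinite in both directions because `g` is defined on the whole line. -/
structure IsDivider (F₁ F₂ : PlaneDiffeo) (Cu Cs : ConeField) (g : ℝ → ℝ) : Prop where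
  smooth : ContDiff ℝ 1 g
  agree : ∀ y, F₁ (graphCurve g y) = F₂ (graphCurve g y)
  tangent : ∀ y, !₂[deriv g y, 1] ∈ Cs.coneAt (graphCurve g y)
  tangent_image₁ : ∀ y, fderiv ℝ F₁ (graphCurve g y) !₂[deriv g y, 1] ∈
    Cu.coneAt (F₁ (graphCurve g y))
  tangent_image₂ : ∀ y, fderiv ℝ F₂ (graphCurve g y) !₂[deriv g y, 1] ∈
    Cu.coneAt (F₂ (graphCurve g y))

/-- `F₁` and `F₂` are synchronously hyperbolic, with the divider `x = g y`. -/
def SynchronouslyHyperbolic (F₁ F₂ : PlaneDiffeo) (g : ℝ → ℝ) : Prop :=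
  SameOrientation F₁ F₂ ∧
  ∃ r : ℝ, 1 < r ∧ ∃ Ku Ks : Set Plane, IsUniversalPair Ku Ks ∧ ∃ Cu Cs : ConeField,
    (∀ P, Cu.coneAt P ⊆ Ku ∧ Cs.coneAt P ⊆ Ks) ∧
    (PreservesCones F₁ Cu Cs ∧ PreservesCones F₂ Cu Cs) ∧
    (ExpandsCones F₁ Cu Cs r ∧ ExpandsCones F₂ Cu Cs r) ∧
    IsDivider F₁ F₂ Cu Cs g

/-- The closed half-planes of the divider `x = g y`: the left one for the sign `-` (`false`), the
right one for the sign `+` (`true`). -/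
def halfPlane (g : ℝ → ℝ) : Bool → Set Plane
  | false => {P | P 0 ≤ g (P 1)}
  | true => {P | g (P 1) ≤ P 0}

open Classical in
/-- The map that is `F₁` on the left half-plane and `F₂` on the right one. -/
noncomputable def gluedMap (F₁ F₂ : PlaneDiffeo) (g : ℝ → ℝ) (P : Plane) : Plane :=
  if P ∈ halfPlane g false then F₁ P else F₂ P

/-- `Δ` is a trapping region for `F`. -/
def IsTrappingRegion (F : Plane → Plane) (Δ : Set Plane) : Prop :=
  Δ.Nonempty ∧ F '' closure Δ ⊆ interior Δ

/-- The map glued from `F₁` and `F₂` along the divider `x = g y` is Lozi-like, with the trapping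
region `Δ`. -/
structure IsLoziLike (F₁ F₂ : PlaneDiffeo) (g : ℝ → ℝ) (Δ : Set Plane) : Prop where
  hyperbolic : SynchronouslyHyperbolic F₁ F₂ g
  det₁ : ∀ P, (fderiv ℝ F₁ P).det ∈ Ioo (-1 : ℝ) 0
  det₂ : ∀ P, (fderiv ℝ F₂ P).det ∈ Ioo (-1 : ℝ) 0
  trapping : IsTrappingRegion (gluedMap F₁ F₂ g) Δ
  openDisk : Nonempty (Δ ≃ₜ Metric.ball (0 : Plane) 1)
  closedDisk : Nonempty (closure Δ ≃ₜ Metric.closedBall (0 : Plane) 1)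

section Bijectivity

theorem det_plane (C : Plane →L[ℝ] Plane) :
    C.det = C !₂[1, 0] 0 * C !₂[0, 1] 1 - C !₂[0, 1] 0 * C !₂[1, 0] 1 := by
  have h0 : (EuclideanSpace.single 0 1 : Plane) = !₂[1, 0] := by
    ext i; fin_cases i <;> simp
  have h1 : (EuclideanSpace.single 1 1 : Plane) = !₂[0, 1] := by
    ext i; fin_cases i <;> simp
  rw [ContinuousLinearMap.det,
    ← LinearMap.det_toMatrix (EuclideanSpace.basisFun (Fin 2) ℝ).toBasis, Matrix.det_fin_two]
  simp [LinearMap.toMatrix_apply, h0, h1]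

theorem hasDerivAt_plane {γ : ℝ → Plane} {v : Plane} {t : ℝ} :
    HasDerivAt γ v t ↔ ∀ i, HasDerivAt (fun x => γ x i) (v i) t := by
  constructor
  · intro h i
    exact (EuclideanSpace.proj i : Plane →L[ℝ] ℝ).hasFDerivAt.comp_hasDerivAt t h
  · intro h
    have h1 : HasDerivAt (fun x i => γ x i) (fun i => v i) t := hasDerivAt_pi.mpr h
    exact (EuclideanSpace.equiv (Fin 2) ℝ).symm.hasFDerivAt.comp_hasDerivAt t h1

/-- A homeomorphism that fixes the curve `x = g y` pointwise and preserves the orientation at one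
of its points preserves both sides of the curve. -/
theorem side_preserved {g : ℝ → ℝ} (hg : ContDiff ℝ 1 g) (H : Plane ≃ Plane)
    (hc : Continuous H) (hfix : ∀ y, H (graphCurve g y) = graphCurve g y)
    {C : Plane →L[ℝ] Plane} (hC : HasFDerivAt H C (graphCurve g 0)) (hdet : 0 < C.det) :
    (∀ P, P 0 < g (P 1) → (H P) 0 < g ((H P) 1)) ∧
    (∀ P, g (P 1) < P 0 → g ((H P) 1) < (H P) 0) := by
  set s : Plane → ℝ := fun P => P 0 - g (P 1) with hs
  have hgc : Continuous g := hg.continuous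
  have hsc : Continuous s := by fun_prop
  have hgraph : ∀ P, s P = 0 → graphCurve g (P 1) = P := by
    intro P hP
    have : P 0 = g (P 1) := sub_eq_zero.mp hP
    ext i; fin_cases i <;> simp [graphCurve, this]
  have hne : ∀ P, s P ≠ 0 → s (H P) ≠ 0 := by
    intro P hP h0
    apply hP
    have h1 := hgraph _ h0
    have h2 := hfix ((H P) 1)
    rw [h1] at h2
    rw [← H.injective h2]; exact h0
  have hgd : HasDerivAt g (deriv g 0) 0 := (hg.differentiable one_ne_zero 0).hasDerivAt
  have hτ : C !₂[deriv g 0, 1] = !₂[deriv g 0, 1] := by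
    have hγ : HasDerivAt (graphCurve g) !₂[deriv g 0, 1] 0 := by
      rw [hasDerivAt_plane]
      intro i
      fin_cases i
      · simpa [graphCurve] using hgd
      · simpa [graphCurve] using hasDerivAt_id' (0 : ℝ)
    have h1 := hC.comp_hasDerivAt (0 : ℝ) hγ
    have h2 : H ∘ graphCurve g = graphCurve g := funext hfix
    rw [h2] at h1
    exact h1.unique hγ
  have hpos : 0 < C !₂[1, 0] 0 - deriv g 0 * C !₂[1, 0] 1 := by
    have hdec : (!₂[deriv g 0, 1] : Plane) = deriv g 0 • !₂[1, 0] + !₂[0, 1] := by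
      ext i; fin_cases i <;> simp
    rw [det_plane] at hdet
    rw [hdec, map_add, map_smul] at hτ
    have e0 := congrArg (fun P : Plane => P 0) hτ
    have e1 := congrArg (fun P : Plane => P 1) hτ
    simp at e0 e1
    have e0' : C !₂[0, 1] 0 = deriv g 0 - deriv g 0 * C !₂[1, 0] 0 := by linarith
    have e1' : C !₂[0, 1] 1 = 1 - deriv g 0 * C !₂[1, 0] 1 := by linarith
    rw [e0', e1'] at hdet
    nlinarith
  set line : ℝ → Plane := fun t => !₂[t + g 0, 0] with hline
  have hline_s : ∀ t, s (line t) = t := by intro t; simp [hs, hline]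
  have hline0 : line 0 = graphCurve g 0 := by simp [hline, graphCurve]
  have hlined : HasDerivAt line !₂[1, 0] 0 := by
    rw [hasDerivAt_plane]
    intro i
    fin_cases i
    · simpa [hline] using (hasDerivAt_id (0 : ℝ)).add_const (g 0)
    · simpa [hline] using hasDerivAt_const (0 : ℝ) (0 : ℝ)
  have hφ : HasDerivAt (fun t => s (H (line t))) (C !₂[1, 0] 0 - deriv g 0 * C !₂[1, 0] 1) 0 := by
    rw [← hline0] at hC
    have h1 := hC.comp_hasDerivAt (0 : ℝ) hlined
    rw [hasDerivAt_plane] at h1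
    have h2 : (H (line 0)) 1 = 0 := by
      rw [hline0, hfix]; simp [graphCurve]
    have h3 : HasDerivAt g (deriv g 0) ((H ∘ line) 0 1) := by
      rw [Function.comp_apply, h2]; exact hgd
    exact (h1 0).sub (h3.comp (0 : ℝ) (h1 1))
  have hφ0 : s (H (line 0)) = 0 := by rw [hline0, hfix]; simp [hs, graphCurve]
  have hslope := hφ.tendsto_slope.eventually (lt_mem_nhds hpos)
  have hL : ∃ t < 0, s (H (line t)) < 0 := by
    have h1 : 𝓝[<] (0 : ℝ) ≤ 𝓝[≠] 0 := nhdsWithin_mono _ fun x hx => ne_of_lt hx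
    obtain ⟨t, ht, ht0⟩ := ((hslope.filter_mono h1).and self_mem_nhdsWithin).exists
    refine ⟨t, ht0, ?_⟩
    have ht0' : t < 0 := ht0
    rw [slope_def_field, hφ0, sub_zero, sub_zero] at ht
    by_contra hcon
    exact absurd ht (not_lt.mpr (div_nonpos_of_nonneg_of_nonpos (not_lt.mp hcon) ht0'.le))
  have hR : ∃ t > 0, 0 < s (H (line t)) := by
    have h1 : 𝓝[>] (0 : ℝ) ≤ 𝓝[≠] 0 := nhdsWithin_mono _ fun x hx => ne_of_gt hx
    obtain ⟨t, ht, ht0⟩ := ((hslope.filter_mono h1).and self_mem_nhdsWithin).exists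
    refine ⟨t, ht0, ?_⟩
    have ht0' : 0 < t := ht0
    rw [slope_def_field, hφ0, sub_zero, sub_zero] at ht
    by_contra hcon
    exact absurd ht (not_lt.mpr (div_nonpos_of_nonpos_of_nonneg (not_lt.mp hcon) ht0'.le))
  have hconn : ∀ I : Set ℝ, Convex ℝ I → IsPreconnected {P | s P ∈ I} := by
    intro I hI
    have h1 : {P | s P ∈ I} = (fun q : ℝ × ℝ => (!₂[q.1 + g q.2, q.2] : Plane)) '' (I ×ˢ univ) := by
      ext P
      constructor
      · intro hP
        refine ⟨(s P, P 1), ⟨hP, mem_univ _⟩, ?_⟩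
        ext i; fin_cases i <;> simp [hs]
      · rintro ⟨q, hq, rfl⟩
        simpa [hs] using hq.1
    rw [h1]
    refine (hI.prod convex_univ).isPreconnected.image _ (Continuous.continuousOn ?_)
    fun_prop
  have hsH : Continuous fun P => s (H P) := hsc.comp hc
  constructor
  · intro P hP
    have hP' : s P < 0 := sub_neg.mpr hP
    obtain ⟨t, ht, hts⟩ := hL
    by_contra hcon
    have hcon' : 0 ≤ s (H P) := sub_nonneg.mpr (not_lt.mp hcon)
    obtain ⟨Q, hQ, hQ0⟩ := (hconn (Iio 0) (convex_Iio 0)).intermediate_value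
      (a := line t) (b := P) (by simpa [hline_s] using ht) hP' hsH.continuousOn
      ⟨hts.le, hcon'⟩
    exact hne Q (ne_of_lt hQ) hQ0
  · intro P hP
    have hP' : 0 < s P := sub_pos.mpr hP
    obtain ⟨t, ht, hts⟩ := hR
    by_contra hcon
    have hcon' : s (H P) ≤ 0 := sub_nonpos.mpr (not_lt.mp hcon)
    obtain ⟨Q, hQ, hQ0⟩ := (hconn (Ioi 0) (convex_Ioi 0)).intermediate_value
      (a := P) (b := line t) hP' (by simpa [hline_s] using ht) hsH.continuousOn
      ⟨hcon', hts.le⟩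
    exact hne Q (ne_of_gt hQ) hQ0

theorem SynchronouslyHyperbolic.bijective {F₁ F₂ : PlaneDiffeo} {g : ℝ → ℝ}
    (h : SynchronouslyHyperbolic F₁ F₂ g) : Function.Bijective (gluedMap F₁ F₂ g) := by
  obtain ⟨hor, _, _, _, _, _, _, _, _, _, _, hdiv⟩ := h
  have hF₁ : ContDiff ℝ 1 F₁ := contMDiff_iff_contDiff.mp F₁.contMDiff
  have hF₂ : ContDiff ℝ 1 F₂ := contMDiff_iff_contDiff.mp F₂.contMDiff
  have hS₂ : ContDiff ℝ 1 F₂.symm := contMDiff_iff_contDiff.mp F₂.symm.contMDiff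
  let H : Plane ≃ Plane := F₁.toEquiv.trans F₂.symm.toEquiv
  have hHdef : ∀ P, H P = F₂.symm (F₁ P) := fun _ => rfl
  have hHF : ∀ P, F₂ (H P) = F₁ P := fun P => by rw [hHdef]; exact F₂.apply_symm_apply _
  have hHs : ContDiff ℝ 1 H := hS₂.comp hF₁
  have hfix : ∀ y, H (graphCurve g y) = graphCurve g y := by
    intro y
    rw [hHdef, hdiv.agree]; exact F₂.symm_apply_apply _
  have hHd : HasFDerivAt H (fderiv ℝ H (graphCurve g 0)) (graphCurve g 0) :=
    (hHs.differentiable one_ne_zero _).hasFDerivAt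
  have hdet : 0 < (fderiv ℝ H (graphCurve g 0)).det := by
    have h1 : HasFDerivAt F₂ (fderiv ℝ F₂ (graphCurve g 0)) (H (graphCurve g 0)) := by
      rw [hfix]; exact (hF₂.differentiable one_ne_zero _).hasFDerivAt
    have h2 := h1.comp _ hHd
    have h3 : F₂ ∘ H = F₁ := funext hHF
    rw [h3] at h2
    have h4 : (fderiv ℝ F₁ (graphCurve g 0)).det =
        (fderiv ℝ F₂ (graphCurve g 0)).det * (fderiv ℝ H (graphCurve g 0)).det := by
      rw [h2.fderiv]
      exact LinearMap.det_comp _ _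
    rcases hor with hor | hor
    · obtain ⟨a, b⟩ := hor (graphCurve g 0)
      rw [h4] at a
      exact pos_of_mul_pos_right a b.le
    · obtain ⟨a, b⟩ := hor (graphCurve g 0)
      rw [h4] at a
      by_contra hcon
      exact absurd a (not_lt.mpr (mul_nonneg_of_nonpos_of_nonpos b.le (not_lt.mp hcon)))
  obtain ⟨hL, hR⟩ := side_preserved hdiv.smooth H hHs.continuous hfix hHd hdet
  have hL' : ∀ P, P 0 ≤ g (P 1) → (H P) 0 ≤ g ((H P) 1) := by
    intro P hP
    rcases hP.lt_or_eq with hlt | heq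
    · exact (hL P hlt).le
    · have : graphCurve g (P 1) = P := by
        ext i; fin_cases i <;> simp [graphCurve, heq]
      rw [← this, hfix]; simp [graphCurve]
  have hval : ∀ P, gluedMap F₁ F₂ g P = F₂ (if P 0 ≤ g (P 1) then H P else P) := by
    intro P
    by_cases hP : P 0 ≤ g (P 1)
    · simp [gluedMap, halfPlane, hP, hHF]
    · simp [gluedMap, halfPlane, hP]
  constructor
  · intro P Q hPQ
    rw [hval, hval] at hPQ
    have hPQ := F₂.injective hPQ
    split_ifs at hPQ with hP hQ hQ
    · exact H.injective hPQ
    · exact absurd (hPQ ▸ hL' P hP) hQ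
    · exact absurd (hPQ ▸ hL' Q hQ) hP
    · exact hPQ
  · intro Q
    by_cases hQ : (F₂.symm Q) 0 ≤ g ((F₂.symm Q) 1)
    · refine ⟨H.symm (F₂.symm Q), ?_⟩
      have : (H.symm (F₂.symm Q)) 0 ≤ g ((H.symm (F₂.symm Q)) 1) := by
        by_contra hcon
        have := hR _ (not_le.mp hcon)
        rw [H.apply_symm_apply] at this
        exact absurd hQ (not_le.mpr this)
      rw [hval, if_pos this, H.apply_symm_apply]
      exact F₂.apply_symm_apply _
    · refine ⟨F₂.symm Q, ?_⟩
      rw [hval, if_neg hQ]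
      exact F₂.apply_symm_apply _

end Bijectivity

/-- The map glued from `F₁` and `F₂`, as an invertible map, so that its iterates `F ^ n` are
defined for all integers `n`. -/
noncomputable def SynchronouslyHyperbolic.glued {F₁ F₂ : PlaneDiffeo} {g : ℝ → ℝ}
    (h : SynchronouslyHyperbolic F₁ F₂ g) : Equiv.Perm Plane :=
  Equiv.ofBijective (gluedMap F₁ F₂ g) h.bijective

/-- The set `Λ`, the intersection of the forward images `F ^ n (Δ)`. -/
def attractor (F : Equiv.Perm Plane) (Δ : Set Plane) : Set Plane :=
  ⋂ n : ℕ, (F ^ n) '' Δ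

/-- The sequence of signs `p` is an itinerary of `P`. -/
def IsItinerary (F : Equiv.Perm Plane) (g : ℝ → ℝ) (P : Plane) (p : ℤ → Bool) : Prop :=
  ∀ n : ℤ, (F ^ n) P ∈ halfPlane g (p n)

/-- The space of admissible sequences, with the topology induced by the product topology. -/
def admissible (F : Equiv.Perm Plane) (g : ℝ → ℝ) (Δ : Set Plane) : Set (ℤ → Bool) :=
  {p | ∃ P ∈ attractor F Δ, IsItinerary F g P p}

/-- The coding map: it sends an admissible sequence to a point of `Λ` with this itinerary. -/
noncomputable def codingMap (F : Equiv.Perm Plane) (g : ℝ → ℝ) (Δ : Set Plane)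
    (p : admissible F g Δ) : attractor F Δ :=
  ⟨p.2.choose, p.2.choose_spec.1⟩

theorem ConeField.exists_smooth_section (C : ConeField) :
    ∃ V : Plane → Plane, ContDiff ℝ 1 V ∧ ∀ P, V P ∈ C.coneAt P ∧ 1 ≤ ‖V P‖ ∧ ‖V P‖ ≤ 2 := by
  let t : Plane → Set Plane := fun P =>
    {w | C.coeff P * ‖w‖ ≤ inner ℝ w (C.axis P)} ∩ {w | 1 ≤ inner ℝ w (C.axis P)} ∩ {w | ‖w‖ ≤ 2}
  have hconv : ∀ P, Convex ℝ (t P) := by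
    intro P
    have hn : ConvexOn ℝ univ (fun w : Plane => C.coeff P * ‖w‖ - inner ℝ w (C.axis P)) := by
      refine ((convexOn_norm convex_univ).smul (C.coeff_mem P).1.le).sub ?_
      refine ⟨convex_univ, fun x _ y _ a b _ _ _ => ?_⟩
      simp [inner_add_left, inner_smul_left]
    refine (Convex.inter ?_ ?_).inter ?_
    · simpa using hn.convex_le 0
    · intro x hx y hy a b ha hb hab
      simp only [mem_ofPred_eq, inner_add_left, inner_smul_left] at *
      simp
      nlinarith
    · have hball : {w : Plane | ‖w‖ ≤ 2} = Metric.closedBall 0 2 :=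
        Set.ext fun w => mem_closedBall_zero_iff.symm
      rw [hball]
      exact convex_closedBall 0 2
  obtain ⟨V, hV⟩ := exists_contMDiffMap_forall_mem_convex_of_local_const (n := 1) 𝓘(ℝ, Plane)
    hconv (by
      intro P
      have hc := C.continuous_axis
      have hl := C.continuous_coeff
      have hin : inner ℝ (C.axis P) (C.axis P) = (1 : ℝ) := by
        rw [real_inner_self_eq_norm_sq, C.norm_axis]; norm_num
      have hnorm : ‖(3 / 2 : ℝ) • C.axis P‖ = 3 / 2 := by
        rw [norm_smul, C.norm_axis]; norm_num
      refine ⟨(3 / 2 : ℝ) • C.axis P, ?_⟩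
      have h1 : ∀ᶠ Q in 𝓝 P, C.coeff Q * ‖(3 / 2 : ℝ) • C.axis P‖
          < inner ℝ ((3 / 2 : ℝ) • C.axis P) (C.axis Q) := by
        refine ContinuousAt.eventually_lt (by fun_prop) (by fun_prop) ?_
        rw [hnorm, real_inner_smul_left, hin]
        linarith [(C.coeff_mem P).2]
      have h2 : ∀ᶠ Q in 𝓝 P, 1 < inner ℝ ((3 / 2 : ℝ) • C.axis P) (C.axis Q) := by
        refine ContinuousAt.eventually_lt (by fun_prop) (by fun_prop) ?_
        rw [real_inner_smul_left, hin]
        norm_num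
      filter_upwards [h1, h2] with Q hQ1 hQ2
      refine ⟨⟨hQ1.le, hQ2.le⟩, ?_⟩
      simp only [mem_ofPred_eq, hnorm]
      norm_num)
  refine ⟨V, contMDiff_iff_contDiff.mp V.contMDiff, fun P => ?_⟩
  obtain ⟨⟨h1, h2⟩, h3⟩ := hV P
  refine ⟨show C.coeff P * ‖V P‖ ≤ _ from h1.trans (le_abs_self _), ?_, h3⟩
  have := real_inner_le_norm (V P) (C.axis P)
  rw [C.norm_axis, mul_one] at this
  exact le_trans h2 this

theorem exists_global_solution {V : Plane → Plane} (hV : ContDiff ℝ 1 V) {L : ℝ}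
    (hL : ∀ P, ‖V P‖ ≤ L) (P : Plane) :
    ∃ γ : ℝ → Plane, γ 0 = P ∧ ∀ t, HasDerivAt γ (V (γ t)) t := by
  have hL0 : 0 ≤ L := (norm_nonneg _).trans (hL P)
  have hloc : ∀ Q : Plane, ∃ γ : ℝ → Plane, γ 0 = Q ∧
      IsMIntegralCurveOn (I := 𝓘(ℝ, Plane)) γ V (Ioo (-1) 1) := by
    intro Q
    obtain ⟨K, hK⟩ := hV.contDiffOn.exists_lipschitzOnWith one_ne_zero
      (convex_closedBall Q L) (isCompact_closedBall Q L)
    have hpl : IsPicardLindelof (fun _ => V) (tmin := -1) (tmax := 1) ⟨0, by norm_num⟩ Q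
        ⟨L, hL0⟩ 0 ⟨L, hL0⟩ K :=
      .of_time_independent (fun x _ => hL x) hK (by simp)
    obtain ⟨γ, hγ0, hγ⟩ := hpl.exists_eq_forall_mem_Icc_hasDerivWithinAt₀
    refine ⟨γ, hγ0, fun t ht => ?_⟩
    exact ((hγ t (Ioo_subset_Icc_self ht)).mono Ioo_subset_Icc_self).hasFDerivWithinAt.hasMFDerivWithinAt
  obtain ⟨γ, hγ0, hγ⟩ := exists_isMIntegralCurve_of_isMIntegralCurveOn (I := 𝓘(ℝ, Plane))
    (v := V) (contMDiff_vectorSpace_iff_contDiff.mpr hV) one_pos hloc P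
  exact ⟨γ, hγ0, fun t => (hγ t).hasFDerivAt⟩

theorem ConeField.exists_tangent_curve (C : ConeField) (P : Plane) :
    ∃ γ γ' : ℝ → Plane, γ 0 = P ∧
      ∀ t, HasDerivAt γ (γ' t) t ∧ γ' t ∈ C.coneAt (γ t) ∧ 1 ≤ ‖γ' t‖ := by
  obtain ⟨V, hV, hVC⟩ := C.exists_smooth_section
  obtain ⟨γ, hγ0, hγ⟩ := exists_global_solution hV (fun Q => (hVC Q).2.2) P
  exact ⟨γ, fun t => V (γ t), hγ0, fun t => ⟨hγ t, (hVC _).1, (hVC _).2.1⟩⟩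

theorem abs_sub_le_mul_abs_sub_of_deriv {f f' h h' : ℝ → ℝ} {a : ℝ}
    (hf : ∀ t, HasDerivAt f (f' t) t) (hh : ∀ t, HasDerivAt h (h' t) t)
    (hne : ∀ t, h' t ≠ 0) (ha : ∀ t, |f' t| ≤ a * |h' t|) (s t : ℝ) :
    |f t - f s| ≤ a * |h t - h s| := by
  wlog hst : s < t generalizing s t
  · rcases (not_lt.mp hst).lt_or_eq with hts | hts
    · rw [abs_sub_comm (f t), abs_sub_comm (h t)]
      exact this t s hts
    · simp [hts]
  obtain ⟨c, -, hc⟩ := exists_ratio_hasDerivAt_eq_ratio_slope h h' hst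
    (fun x _ => (hh x).continuousAt.continuousWithinAt) (fun x _ => hh x) f f'
    (fun x _ => (hf x).continuousAt.continuousWithinAt) (fun x _ => hf x)
  have hc' := congrArg abs hc
  rw [abs_mul, abs_mul] at hc'
  refine le_of_mul_le_mul_right ?_ (abs_pos.mpr (hne c))
  calc |f t - f s| * |h' c| = |h t - h s| * |f' c| := hc'
    _ ≤ |h t - h s| * (a * |h' c|) := by gcongr; exact ha c
    _ = a * |h t - h s| * |h' c| := by ring

theorem surjective_of_le_abs_deriv {f f' : ℝ → ℝ} {δ : ℝ} (hδ : 0 < δ)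
    (hf : ∀ t, HasDerivAt f (f' t) t) (hf' : ∀ t, δ ≤ |f' t|) : Function.Surjective f := by
  have key : ∀ s t, δ * |t - s| ≤ |f t - f s| := by
    intro s t
    have h := abs_sub_le_mul_abs_sub_of_deriv (f := id) (a := δ⁻¹) (fun t => hasDerivAt_id t) hf
      (fun t => abs_pos.mp (hδ.trans_le (hf' t)))
      (fun t => by
        rw [abs_one, inv_mul_eq_div, one_le_div hδ]
        exact hf' t) s t
    rw [inv_mul_eq_div, le_div_iff₀ hδ] at h
    simp only [id] at h
    linarith
  have hcont : Continuous f := continuous_iff_continuousAt.mpr fun t => (hf t).continuousAt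
  have hinj : Function.Injective f := by
    intro s t hst
    have := key s t
    rw [hst, sub_self, abs_zero] at this
    have h0 : |t - s| ≤ 0 := nonpos_of_mul_nonpos_right this hδ
    linarith [abs_nonpos_iff.mp h0]
  intro c
  set T : ℝ := |c - f 0| / δ with hT
  have hT0 : 0 ≤ T := by positivity
  have hTm : δ * T = |c - f 0| := by rw [hT]; field_simp
  have h1 := key 0 T
  have h2 := key 0 (-T)
  rw [sub_zero, abs_of_nonneg hT0, hTm] at h1
  rw [sub_zero, abs_neg, abs_of_nonneg hT0, hTm] at h2
  have hmem : c ∈ uIcc (f (-T)) (f T) := by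
    rw [mem_uIcc]
    have hle : -T ≤ T := by linarith
    rcases hcont.strictMono_of_inj hinj with hm | hm
    · left
      have a1 := hm.monotone hT0
      have a2 := hm.monotone (show -T ≤ 0 by linarith)
      rw [abs_of_nonneg (sub_nonneg.mpr a1)] at h1
      rw [abs_of_nonpos (sub_nonpos.mpr a2)] at h2
      constructor <;> linarith [le_abs_self (c - f 0), neg_abs_le (c - f 0)]
    · right
      have a1 := hm.antitone hT0
      have a2 := hm.antitone (show -T ≤ 0 by linarith)
      rw [abs_of_nonpos (sub_nonpos.mpr a1)] at h1
      rw [abs_of_nonneg (sub_nonneg.mpr a2)] at h2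
      constructor <;> linarith [le_abs_self (c - f 0), neg_abs_le (c - f 0)]
  obtain ⟨t, -, ht⟩ := intermediate_value_uIcc hcont.continuousOn hmem
  exact ⟨t, ht⟩

theorem exists_intersection {γ β : ℝ → Plane} {a b : ℝ} (ha : 0 ≤ a) (hb : 0 ≤ b)
    (hab : a * b < 1) (hγ : Function.Surjective fun t => γ t 0)
    (hβ : Function.Surjective fun t => β t 1)
    (hγa : ∀ s t, |γ t 1 - γ s 1| ≤ a * |γ t 0 - γ s 0|)
    (hβb : ∀ s t, |β t 0 - β s 0| ≤ b * |β t 1 - β s 1|) : ∃ t s, γ t = β s := by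
  choose σ hσ using hγ
  choose τ hτ using hβ
  have hlip : LipschitzWith ⟨a * b, mul_nonneg ha hb⟩ (fun x => β (τ (γ (σ x) 1)) 0) := by
    refine LipschitzWith.of_dist_le_mul fun x y => ?_
    simp only [Real.dist_eq]
    have h1 := hβb (τ (γ (σ y) 1)) (τ (γ (σ x) 1))
    have h2 := hγa (σ y) (σ x)
    simp only [] at hσ hτ
    rw [hτ, hτ] at h1
    rw [hσ, hσ] at h2
    calc _ ≤ b * |γ (σ x) 1 - γ (σ y) 1| := h1
      _ ≤ b * (a * |x - y|) := by gcongr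
      _ = a * b * |x - y| := by ring
  have hc : ContractingWith ⟨a * b, mul_nonneg ha hb⟩ (fun x => β (τ (γ (σ x) 1)) 0) :=
    ⟨by exact_mod_cast hab, hlip⟩
  have hfix : β (τ (γ (σ hc.fixedPoint) 1)) 0 = hc.fixedPoint := hc.fixedPoint_isFixedPt
  refine ⟨σ hc.fixedPoint, τ (γ (σ hc.fixedPoint) 1), ?_⟩
  ext i
  fin_cases i
  · exact (hσ _).trans hfix.symm
  · exact (hτ _).symm

theorem ConeField.exists_pushed_curves (C : ConeField) {f : ℕ → Plane → Plane} {r : ℝ}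
    (hr : 1 < r) (hf : ∀ k, Differentiable ℝ (f k))
    (hC : ∀ k P, MapsTo (fderiv ℝ (f k) P) (C.coneAt P) (C.coneAt (f k P)))
    (hexp : ∀ k P, ∀ u ∈ C.coneAt P, r * ‖u‖ ≤ ‖fderiv ℝ (f k) P u‖) (P : Plane) :
    ∃ A A' : ℕ → ℝ → Plane, A 0 0 = P ∧ (∀ k t, A (k + 1) t = f k (A k t)) ∧
      (∀ k t, HasDerivAt (A k) (A' k t) t ∧ A' k t ∈ C.coneAt (A k t) ∧ 1 ≤ ‖A' k t‖) ∧
      ∀ k j t, r ^ j * ‖A' k t‖ ≤ ‖A' (k + j) t‖ := by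
  obtain ⟨γ, γ', h0, hγ⟩ := C.exists_tangent_curve P
  let D : ℕ → (ℝ → Plane) × (ℝ → Plane) := fun n => n.rec (γ, γ') fun k q =>
    (fun t => f k (q.1 t), fun t => fderiv ℝ (f k) (q.1 t) (q.2 t))
  have hD : ∀ k t, HasDerivAt (D k).1 ((D k).2 t) t ∧ (D k).2 t ∈ C.coneAt ((D k).1 t) ∧
      1 ≤ ‖(D k).2 t‖ := by
    intro k
    induction k with
    | zero => exact hγ
    | succ k ih =>
      intro t
      obtain ⟨h1, h2, h3⟩ := ih t
      refine ⟨(hf k _).hasFDerivAt.comp_hasDerivAt t h1, hC k _ h2, ?_⟩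
      have := hexp k _ _ h2
      have h4 : 1 * 1 ≤ r * ‖(D k).2 t‖ := by gcongr
      exact (one_mul (1 : ℝ)) ▸ h4.trans this
  refine ⟨fun k => (D k).1, fun k => (D k).2, h0, fun _ _ => rfl, hD, fun k j t => ?_⟩
  induction j with
  | zero => simp
  | succ j ih =>
    calc r ^ (j + 1) * ‖(D k).2 t‖ = r * (r ^ j * ‖(D k).2 t‖) := by ring
      _ ≤ r * ‖(D (k + j)).2 t‖ := by gcongr
      _ ≤ _ := hexp (k + j) _ _ (hD _ t).2.1

/-- A family of curves whose `i`-th coordinate dominates the `j`-th one with the factor `a`, and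
whose `i`-th coordinate is expanded in time with the rate `r` up to the factor `ℓ`. -/
structure IsExpandingFamily (A : ℕ → ℝ → Plane) (i j : Fin 2) (a ℓ r : ℝ) : Prop where
  surjective : ∀ k, Function.Surjective fun t => A k t i
  slope : ∀ k s t, |A k t j - A k s j| ≤ a * |A k t i - A k s i|
  expand : ∀ k m s t, ℓ * r ^ m * |A k t i - A k s i| ≤ |A (k + m) t i - A (k + m) s i|

theorem ConeField.exists_expandingFamily (C : ConeField) {f : ℕ → Plane → Plane} {r a ℓ : ℝ}
    {i j : Fin 2} (hr : 1 < r) (hf : ∀ k, Differentiable ℝ (f k))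
    (hC : ∀ k P, MapsTo (fderiv ℝ (f k) P) (C.coneAt P) (C.coneAt (f k P)))
    (hexp : ∀ k P, ∀ u ∈ C.coneAt P, r * ‖u‖ ≤ ‖fderiv ℝ (f k) P u‖) (hℓ : 0 < ℓ)
    (hi : ∀ P, ∀ u ∈ C.coneAt P, ℓ * ‖u‖ ≤ |u i|)
    (ha : ∀ P, ∀ u ∈ C.coneAt P, |u j| ≤ a * |u i|) (P : Plane) :
    ∃ A : ℕ → ℝ → Plane, A 0 0 = P ∧ (∀ k t, A (k + 1) t = f k (A k t)) ∧
      IsExpandingFamily A i j a ℓ r := by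
  obtain ⟨A, A', h0, hA, hA', hAr⟩ := C.exists_pushed_curves hr hf hC hexp P
  have hd : ∀ k t e, HasDerivAt (fun t => A k t e) (A' k t e) t :=
    fun k t => hasDerivAt_plane.mp (hA' k t).1
  have hlow : ∀ k t, ℓ ≤ |A' k t i| := by
    intro k t
    have h1 := hi _ _ (hA' k t).2.1
    nlinarith [(hA' k t).2.2]
  have hne : ∀ k t, A' k t i ≠ 0 := fun k t => abs_pos.mp (hℓ.trans_le (hlow k t))
  refine ⟨A, h0, hA, fun k => surjective_of_le_abs_deriv hℓ (fun t => hd k t i) (hlow k),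
    fun k s t => abs_sub_le_mul_abs_sub_of_deriv (fun t => hd k t j) (fun t => hd k t i) (hne k)
      (fun t => ha _ _ (hA' k t).2.1) s t, fun k m s t => ?_⟩
  have hpos : 0 < ℓ * r ^ m := by positivity
  have h := abs_sub_le_mul_abs_sub_of_deriv (a := (ℓ * r ^ m)⁻¹) (fun t => hd k t i)
    (fun t => hd (k + m) t i) (hne _) (fun t => by
      rw [inv_mul_eq_div, le_div_iff₀ hpos]
      have hle : |A' k t i| ≤ ‖A' k t‖ := PiLp.norm_apply_le (A' k t) i
      calc |A' k t i| * (ℓ * r ^ m) ≤ ‖A' k t‖ * (ℓ * r ^ m) := by gcongr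
        _ = ℓ * (r ^ m * ‖A' k t‖) := by ring
        _ ≤ ℓ * ‖A' (k + m) t‖ := by gcongr; exact hAr k m t
        _ ≤ _ := hi _ _ (hA' _ t).2.1) s t
  rw [inv_mul_eq_div, le_div_iff₀ hpos] at h
  linarith

theorem PlaneDiffeo.differentiable (F : PlaneDiffeo) : Differentiable ℝ F :=
  (contMDiff_iff_contDiff.mp F.contMDiff).differentiable one_ne_zero

theorem IsUniversalPair.exists_slopes {Ku Ks : Set Plane} (h : IsUniversalPair Ku Ks) :
    ∃ ℓu > 0, ∃ ℓs > 0, ∃ a ≥ 0, ∃ b ≥ 0, a * b < (1 : ℝ) ∧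
      (∀ u ∈ Ku, ℓu * ‖u‖ ≤ |u 0| ∧ |u 1| ≤ a * |u 0|) ∧
      (∀ u ∈ Ks, ℓs * ‖u‖ ≤ |u 1| ∧ |u 0| ≤ b * |u 1|) := by
  obtain ⟨⟨p, ⟨hp0, hp1⟩, rfl⟩, ⟨q, ⟨hq0, hq1⟩, rfl⟩, hpq⟩ := h
  have hin0 : ∀ u : Plane, inner ℝ u !₂[1, 0] = u 0 := fun u => by
    simp [PiLp.inner_apply, Fin.sum_univ_two]
  have hin1 : ∀ u : Plane, inner ℝ u !₂[0, 1] = u 1 := fun u => by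
    simp [PiLp.inner_apply, Fin.sum_univ_two]
  have hnorm : ∀ u : Plane, ‖u‖ ^ 2 = u 0 ^ 2 + u 1 ^ 2 := fun u => by
    simp [EuclideanSpace.norm_sq_eq, Fin.sum_univ_two]
  have hsum : 1 < p ^ 2 + q ^ 2 := by
    by_contra hle
    set w : Plane := !₂[p, √(1 - p ^ 2)] with hw
    have hs : √(1 - p ^ 2) ^ 2 = 1 - p ^ 2 := Real.sq_sqrt (by nlinarith)
    have hw1 : ‖w‖ = 1 := by
      rw [← pow_left_inj₀ (norm_nonneg w) zero_le_one two_ne_zero, hnorm]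
      simp [hw, hs]
    have hmem : w ∈ cone !₂[1, 0] p ∩ cone !₂[0, 1] q := by
      constructor
      · simp only [cone, mem_ofPred_eq, hin0, hw1]
        simp [hw, le_abs_self]
      · simp only [cone, mem_ofPred_eq, hin1, hw1, mul_one]
        refine le_trans ?_ (le_abs_self _)
        simp only [hw]
        exact Real.le_sqrt_of_sq_le (by linarith)
    rw [hpq, mem_singleton_iff] at hmem
    rw [hmem, norm_zero] at hw1
    exact zero_ne_one hw1
  have hp2 : p ^ 2 < 1 := by nlinarith
  have hq2 : q ^ 2 < 1 := by nlinarith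
  have slope : ∀ c x y n : ℝ, 0 < c → c ^ 2 < 1 → n ^ 2 = x ^ 2 + y ^ 2 → 0 ≤ n → c * n ≤ |x| →
      |y| ≤ √((1 - c ^ 2) / c ^ 2) * |x| := by
    intro c x y n hc hc1 hn hn0 hle
    refine abs_le_of_sq_le_sq ?_ (by positivity)
    rw [mul_pow, Real.sq_sqrt (div_nonneg (by linarith) (by positivity)), sq_abs,
      div_mul_eq_mul_div, le_div_iff₀ (by positivity)]
    have h2 : (c * n) ^ 2 ≤ |x| ^ 2 := by gcongr
    rw [sq_abs, mul_pow, hn] at h2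
    linarith
  refine ⟨p, hp0, q, hq0, √((1 - p ^ 2) / p ^ 2), Real.sqrt_nonneg _, √((1 - q ^ 2) / q ^ 2),
    Real.sqrt_nonneg _, ?_, fun u hu => ?_, fun u hu => ?_⟩
  · rw [← Real.sqrt_mul (div_nonneg (by linarith) (by positivity)), Real.sqrt_lt' one_pos,
      div_mul_div_comm, one_pow, div_lt_one (by positivity)]
    nlinarith
  · simp only [cone, mem_ofPred_eq, hin0] at hu
    exact ⟨hu, slope p _ _ _ hp0 hp2 (hnorm u) (norm_nonneg u) hu⟩
  · simp only [cone, mem_ofPred_eq, hin1] at hu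
    exact ⟨hu, slope q _ _ _ hq0 hq2 ((hnorm u).trans (add_comm _ _)) (norm_nonneg u) hu⟩

theorem orbits_eq_of_eq {X : Type*} {G : ℕ → X → X} (hG : ∀ k, Function.Injective (G k)) {M n : ℕ}
    {u v : ℕ → X} (hu : ∀ k < M, u (k + 1) = G k (u k)) (hv : ∀ k < M, v (k + 1) = G k (v k))
    (hn : n ≤ M) (h : u n = v n) : ∀ k ≤ M, u k = v k := by
  have h0 : u 0 = v 0 := by
    induction n with
    | zero => exact h
    | succ n ih =>
      rw [hu n hn, hv n hn] at h
      exact ih (Nat.le_of_succ_le hn) (hG n h)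
  intro k
  induction k with
  | zero => exact fun _ => h0
  | succ k ih =>
    intro hk
    rw [hu k hk, hv k hk, ih (Nat.le_of_succ_le hk)]

theorem exists_bound_of_transverse_slopes {a b B : ℝ} (ha : 0 ≤ a) (hb : 0 ≤ b) (hab : a * b < 1)
    {x y z : Plane} (hB : ∀ i, |x i - y i| ≤ B) (hzx : |z 1 - x 1| ≤ a * |z 0 - x 0|)
    (hzy : |z 0 - y 0| ≤ b * |z 1 - y 1|) :
    |z 0 - x 0| ≤ (b + 1) * B / (1 - a * b) ∧ |z 1 - y 1| ≤ (a + 1) * B / (1 - a * b) := by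
  have h0 : |z 0 - x 0| ≤ |z 0 - y 0| + B := by
    have := abs_sub_le (z 0) (y 0) (x 0)
    have := abs_sub_comm (x 0) (y 0)
    linarith [hB 0]
  have h1 : |z 1 - y 1| ≤ |z 1 - x 1| + B := by
    have := abs_sub_le (z 1) (x 1) (y 1)
    linarith [hB 1]
  have h2 := mul_le_mul_of_nonneg_left h1 hb
  have h3 := mul_le_mul_of_nonneg_left hzx hb
  have h4 := mul_le_mul_of_nonneg_left h0 ha
  have h5 := mul_le_mul_of_nonneg_left hzy ha
  rw [le_div_iff₀ (by linarith), le_div_iff₀ (by linarith)]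
  constructor <;> linarith

theorem exists_bound_of_orbits {Cu Cs : ConeField} {r ℓu ℓs a b : ℝ} (hr : 1 < r) (hℓu : 0 < ℓu)
    (hℓs : 0 < ℓs) (ha : 0 ≤ a) (hb : 0 ≤ b) (hab : a * b < 1)
    (hu : ∀ P, ∀ u ∈ Cu.coneAt P, ℓu * ‖u‖ ≤ |u 0| ∧ |u 1| ≤ a * |u 0|)
    (hs : ∀ P, ∀ u ∈ Cs.coneAt P, ℓs * ‖u‖ ≤ |u 1| ∧ |u 0| ≤ b * |u 1|) (B : ℝ) :
    ∃ K, ∀ (G : ℕ → PlaneDiffeo) (x y : ℕ → Plane) (N : ℕ), (∀ k, PreservesCones (G k) Cu Cs) →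
      (∀ k, ExpandsCones (G k) Cu Cs r) → (∀ k, x (k + 1) = G k (x k)) →
      (∀ k, y (k + 1) = G k (y k)) → (∀ k i, |x k i - y k i| ≤ B) →
      ∀ i, r ^ N * |x N i - y N i| ≤ K := by
  set K₀ := (b + 1) * B / (1 - a * b) with hK₀
  set K₁ := (a + 1) * B / (1 - a * b) with hK₁
  refine ⟨(1 + a) * (K₀ / ℓu) + (1 + b) * (K₁ / ℓs), ?_⟩
  intro G x y N hpres hexp hx hy hB
  have hr0 : 0 < r ^ N := by positivity
  obtain ⟨A, hA0, hA, hAf⟩ := Cu.exists_expandingFamily (f := fun k => G k) (i := 0) (j := 1) hr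
    (fun k => (G k).differentiable) (fun k P => (hpres k P).1) (fun k P => (hexp k P).1) hℓu
    (fun P u h => (hu P u h).1) (fun P u h => (hu P u h).2) (x 0)
  obtain ⟨E, hE0, hE, hEf⟩ := Cs.exists_expandingFamily (f := fun k => (G (2 * N - 1 - k)).symm)
    (i := 1) (j := 0) hr (fun k => PlaneDiffeo.differentiable _) (fun k P => (hpres _ P).2)
    (fun k P => (hexp _ P).2) hℓs
    (fun P u h => (hs P u h).1) (fun P u h => (hs P u h).2) (y (2 * N))
  have hinj : ∀ k, Function.Injective (G k) := fun k => (G k).injective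
  have hrev : ∀ s, ∀ k < 2 * N, E (2 * N - (k + 1)) s = G k (E (2 * N - k) s) := by
    intro s k hk
    have h1 := hE (2 * N - (k + 1)) s
    rw [show 2 * N - (k + 1) + 1 = 2 * N - k by omega,
      show 2 * N - 1 - (2 * N - (k + 1)) = k by omega] at h1
    rw [h1]
    exact ((G k).apply_symm_apply _).symm
  obtain ⟨t, s, hts⟩ := exists_intersection ha hb hab (hAf.surjective N) (hEf.surjective N)
    (hAf.slope N) (hEf.slope N)
  have hmeet : ∀ k ≤ 2 * N, A k t = E (2 * N - k) s :=
    orbits_eq_of_eq hinj (v := fun k => E (2 * N - k) s) (fun k _ => hA k t) (hrev s)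
      (show N ≤ 2 * N by omega) (by rwa [show 2 * N - N = N by omega])
  have hAx : ∀ k ≤ 2 * N, A k 0 = x k :=
    orbits_eq_of_eq hinj (fun k _ => hA k 0) (fun k _ => hx k) (Nat.zero_le _) hA0
  have hEy : ∀ k ≤ 2 * N, E (2 * N - k) 0 = y k :=
    orbits_eq_of_eq hinj (u := fun k => E (2 * N - k) 0) (hrev 0) (fun k _ => hy k) le_rfl
      (by rw [Nat.sub_self]; exact hE0)
  have hzx : ∀ k ≤ 2 * N, |A k t 1 - x k 1| ≤ a * |A k t 0 - x k 0| := by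
    intro k hk
    rw [← hAx k hk]
    exact hAf.slope k 0 t
  have hzy : ∀ k ≤ 2 * N, |A k t 0 - y k 0| ≤ b * |A k t 1 - y k 1| := by
    intro k hk
    rw [← hEy k hk, hmeet k hk]
    exact hEf.slope _ 0 s
  have hbound : ∀ k ≤ 2 * N, |A k t 0 - x k 0| ≤ K₀ ∧ |A k t 1 - y k 1| ≤ K₁ := fun k hk =>
    exists_bound_of_transverse_slopes ha hb hab (hB k) (hzx k hk) (hzy k hk)
  have hNN : N ≤ 2 * N := by omega
  have h0 : r ^ N * |A N t 0 - x N 0| ≤ K₀ / ℓu := by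
    have h1 := hAf.expand N N 0 t
    rw [← two_mul, hAx _ hNN, hAx _ le_rfl] at h1
    rw [le_div_iff₀ hℓu]
    linarith [(hbound (2 * N) le_rfl).1]
  have h1 : r ^ N * |A N t 1 - y N 1| ≤ K₁ / ℓs := by
    have h1 := hEf.expand N N 0 s
    have e0 := hmeet N hNN
    have e1 := hEy N hNN
    have e2 := hmeet 0 (Nat.zero_le _)
    have e3 := hEy 0 (Nat.zero_le _)
    rw [show 2 * N - N = N by omega] at e0 e1
    rw [Nat.sub_zero] at e2 e3
    rw [← two_mul, ← e0, ← e2, e1, e3] at h1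
    rw [le_div_iff₀ hℓs]
    linarith [(hbound 0 (Nat.zero_le _)).2]
  have hn0 : 0 ≤ r ^ N * |A N t 0 - x N 0| := by positivity
  have hn1 : 0 ≤ r ^ N * |A N t 1 - y N 1| := by positivity
  have h2 := mul_le_mul_of_nonneg_left (hzx N hNN) hr0.le
  have h3 := mul_le_mul_of_nonneg_left (hzy N hNN) hr0.le
  have ha0 := mul_le_mul_of_nonneg_left h0 ha
  have hb1 := mul_le_mul_of_nonneg_left h1 hb
  have htri : ∀ i, r ^ N * |x N i - y N i| ≤
      r ^ N * |A N t i - x N i| + r ^ N * |A N t i - y N i| := by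
    intro i
    rw [← mul_add, abs_sub_comm (A N t i) (x N i)]
    gcongr
    exact abs_sub_le _ _ _
  intro i
  refine (htri i).trans ?_
  fin_cases i
  · simp only [Fin.zero_eta]
    nlinarith
  · simp only [Fin.mk_one]
    nlinarith

theorem gluedMap_of_mem {F₁ F₂ : PlaneDiffeo} {g : ℝ → ℝ}
    (hagree : ∀ y, F₁ (graphCurve g y) = F₂ (graphCurve g y)) {P : Plane} {s : Bool}
    (hP : P ∈ halfPlane g s) : gluedMap F₁ F₂ g P = (if s then F₂ else F₁ : PlaneDiffeo) P := by
  cases s with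
  | false => simp [gluedMap, hP]
  | true =>
    by_cases h : P ∈ halfPlane g false
    · have h1 : graphCurve g (P 1) = P := by
        have h2 : P 0 = g (P 1) := le_antisymm h hP
        ext i; fin_cases i <;> simp [graphCurve, h2]
      have h3 := hagree (P 1)
      rw [h1] at h3
      simp [gluedMap, h, h3]
    · simp [gluedMap, h]

theorem isClosed_halfPlane {g : ℝ → ℝ} (hg : Continuous g) (s : Bool) :
    IsClosed (halfPlane g s) := by
  cases s
  · exact isClosed_le (by fun_prop) (by fun_prop)
  · exact isClosed_le (by fun_prop) (by fun_prop)

theorem exists_mem_halfPlane (g : ℝ → ℝ) (P : Plane) : ∃ s, P ∈ halfPlane g s :=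
  (le_total (P 0) (g (P 1))).elim (fun h => ⟨false, h⟩) fun h => ⟨true, h⟩

section Glued

variable {F₁ F₂ : PlaneDiffeo} {g : ℝ → ℝ}

theorem SynchronouslyHyperbolic.isDivider (h : SynchronouslyHyperbolic F₁ F₂ g) :
    Continuous g ∧ ∀ y, F₁ (graphCurve g y) = F₂ (graphCurve g y) := by
  obtain ⟨_, _, _, _, _, _, _, _, _, _, _, hdiv⟩ := h
  exact ⟨hdiv.smooth.continuous, hdiv.agree⟩

theorem SynchronouslyHyperbolic.glued_of_mem (h : SynchronouslyHyperbolic F₁ F₂ g) {P : Plane}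
    {s : Bool} (hP : P ∈ halfPlane g s) : h.glued P = (if s then F₂ else F₁ : PlaneDiffeo) P :=
  gluedMap_of_mem h.isDivider.2 hP

theorem SynchronouslyHyperbolic.continuous_glued (h : SynchronouslyHyperbolic F₁ F₂ g) :
    Continuous h.glued := by
  have hcov : (⋃ s, halfPlane g s) = univ :=
    eq_univ_of_forall fun P => mem_iUnion.mpr (exists_mem_halfPlane g P)
  refine (locallyFinite_of_finite _).continuous hcov (isClosed_halfPlane h.isDivider.1)
    fun s => ?_
  exact ((if s then F₂ else F₁ : PlaneDiffeo).continuous.continuousOn).congr fun P hP => h.glued_of_mem hP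

theorem SynchronouslyHyperbolic.isClosedMap_glued (h : SynchronouslyHyperbolic F₁ F₂ g) :
    IsClosedMap h.glued := by
  intro S hS
  have himage : h.glued '' S = ⋃ s : Bool, (if s then F₂ else F₁ : PlaneDiffeo) '' (S ∩ halfPlane g s) := by
    conv_lhs => rw [← inter_univ S, ← eq_univ_of_forall fun P => mem_iUnion.mpr
      (exists_mem_halfPlane g P), inter_iUnion, image_iUnion]
    exact iUnion_congr fun s => image_congr fun P hP => h.glued_of_mem hP.2
  rw [himage]
  exact isClosed_iUnion_of_finite fun s => (if s then F₂ else F₁ : PlaneDiffeo).toHomeomorph.isClosedMap _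
    (hS.inter (isClosed_halfPlane h.isDivider.1 s))

theorem SynchronouslyHyperbolic.continuous_zpow_glued (h : SynchronouslyHyperbolic F₁ F₂ g)
    (n : ℤ) : Continuous (h.glued ^ n : Equiv.Perm Plane) := by
  have hpow : ∀ (e : Equiv.Perm Plane), Continuous e → ∀ k : ℕ,
      Continuous (e ^ k : Equiv.Perm Plane) := by
    intro e he k
    rw [Equiv.Perm.coe_pow]
    exact he.iterate k
  have hinv : Continuous (h.glued⁻¹ : Equiv.Perm Plane) :=
    (h.glued.toHomeomorphOfContinuousClosed h.continuous_glued h.isClosedMap_glued).symm.continuous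
  obtain ⟨k, rfl | rfl⟩ := n.eq_nat_or_neg
  · simpa using hpow _ h.continuous_glued k
  · rw [zpow_neg, zpow_natCast, ← inv_pow]
    exact hpow _ hinv k

theorem SynchronouslyHyperbolic.eq_of_isItinerary (h : SynchronouslyHyperbolic F₁ F₂ g)
    {S : Set Plane} (hS : Bornology.IsBounded S) {p : ℤ → Bool} {P Q : Plane}
    (hP : ∀ n : ℤ, (h.glued ^ n) P ∈ S) (hQ : ∀ n : ℤ, (h.glued ^ n) Q ∈ S)
    (hPp : IsItinerary h.glued g P p) (hQp : IsItinerary h.glued g Q p) : P = Q := by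
  obtain ⟨_, r, hr, Ku, Ks, hK, Cu, Cs, hsub, ⟨hp₁, hp₂⟩, ⟨he₁, he₂⟩, _⟩ := id h
  obtain ⟨ℓu, hℓu, ℓs, hℓs, a, ha, b, hb, hab, hu, hs⟩ := hK.exists_slopes
  obtain ⟨B, hB⟩ := Metric.isBounded_iff.mp hS
  obtain ⟨K, hbound⟩ := exists_bound_of_orbits hr hℓu hℓs ha hb hab
    (fun P u hu' => hu u ((hsub P).1 hu')) (fun P u hu' => hs u ((hsub P).2 hu')) B
  have hstep : ∀ {R : Plane}, IsItinerary h.glued g R p → ∀ N k : ℕ,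
      (h.glued ^ (((k + 1 : ℕ) : ℤ) - N)) R =
        (if p (k - N) then F₂ else F₁ : PlaneDiffeo) ((h.glued ^ ((k : ℤ) - N)) R) := by
    intro R hR N k
    rw [← h.glued_of_mem (hR _), show ((k + 1 : ℕ) : ℤ) - N = 1 + (k - N) by push_cast; ring,
      zpow_one_add, Equiv.Perm.mul_apply]
  have key : ∀ (i : Fin 2) (N : ℕ), r ^ N * |P i - Q i| ≤ K := by
    intro i N
    have h1 := hbound (fun k => if p (k - N) then F₂ else F₁)
      (fun k => (h.glued ^ ((k : ℤ) - N)) P) (fun k => (h.glued ^ ((k : ℤ) - N)) Q) N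
      (fun k => by split_ifs <;> assumption)
      (fun k => by split_ifs <;> assumption)
      (hstep hPp N) (hstep hQp N)
      (fun k j => by
        refine le_trans ?_ (hB (hP (k - N)) (hQ (k - N)))
        rw [dist_eq_norm]
        exact PiLp.norm_apply_le ((h.glued ^ ((k : ℤ) - N)) P - (h.glued ^ ((k : ℤ) - N)) Q) j) i
    simpa using h1
  ext i
  by_contra hne
  have hpos : 0 < |P i - Q i| := abs_pos.mpr (sub_ne_zero.mpr hne)
  obtain ⟨N, hN⟩ := pow_unbounded_of_one_lt (K / |P i - Q i|) hr
  rw [div_lt_iff₀ hpos] at hN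
  exact absurd (key i N) (not_le.mpr hN)

end Glued

section Attractor

variable {X : Type*}

theorem zpow_mem_of_mem_iInter_image {F : Equiv.Perm X} {D : Set X} (hD : F '' D ⊆ D) {P : X}
    (hP : P ∈ ⋂ n : ℕ, (F ^ n : Equiv.Perm X) '' D) (n : ℤ) : (F ^ n) P ∈ D := by
  rw [mem_iInter] at hP
  obtain ⟨k, rfl | rfl⟩ := n.eq_nat_or_neg
  · rw [zpow_natCast]
    have hP0 : P ∈ D := by simpa using hP 0
    induction k with
    | zero => simpa using hP0
    | succ k ih =>
      rw [pow_succ', Equiv.Perm.mul_apply]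
      exact hD (mem_image_of_mem F ih)
  · obtain ⟨Q, hQ, hQP⟩ := hP k
    rw [zpow_neg, zpow_natCast, ← hQP]
    exact ((F ^ k).symm_apply_apply Q).symm ▸ hQ

theorem iInter_image_eq_iInter_image_closure [TopologicalSpace X] {F : Equiv.Perm X} {D : Set X}
    (hD : F '' closure D ⊆ D) :
    ⋂ n : ℕ, (F ^ n : Equiv.Perm X) '' D = ⋂ n : ℕ, (F ^ n : Equiv.Perm X) '' closure D := by
  refine subset_antisymm (iInter_mono fun n => image_mono subset_closure)
    (subset_iInter fun n => (iInter_subset _ (n + 1)).trans ?_)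
  rw [pow_succ, Equiv.Perm.coe_mul, image_comp]
  exact image_mono hD

end Attractor

theorem continuous_of_isClosed_graph_of_compactSpace {X Y : Type*} [TopologicalSpace X]
    [TopologicalSpace Y] [CompactSpace Y] {f : X → Y} (hf : IsClosed {q : X × Y | q.2 = f q.1}) : Continuous f := by
  refine continuous_iff_isClosed.mpr fun S hS => ?_
  have h1 : f ⁻¹' S = Prod.fst '' ({q : X × Y | q.2 = f q.1} ∩ Prod.snd ⁻¹' S) := by
    ext x
    constructor
    · exact fun hx => ⟨(x, f x), ⟨rfl, hx⟩, rfl⟩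
    · rintro ⟨⟨x', y⟩, ⟨hq, hy⟩, rfl⟩
      have hq' : y = f x' := hq
      exact hq' ▸ hy
  rw [h1]
  exact isClosedMap_fst_of_compactSpace _ (hf.inter (hS.preimage continuous_snd))

theorem mainTheorem6 (F₁ F₂ : PlaneDiffeo) (g : ℝ → ℝ) (Δ : Set Plane)
    (hF : IsLoziLike F₁ F₂ g Δ) :
    (∀ (p : admissible hF.hyperbolic.glued g Δ) (P : attractor hF.hyperbolic.glued Δ),
      IsItinerary hF.hyperbolic.glued g P p ↔ P = codingMap hF.hyperbolic.glued g Δ p) ∧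
    Function.Surjective (codingMap hF.hyperbolic.glued g Δ) ∧
    Continuous (codingMap hF.hyperbolic.glued g Δ) := by
  have hcl : hF.hyperbolic.glued '' closure Δ ⊆ Δ := hF.trapping.2.trans interior_subset
  have hcpt : IsCompact (closure Δ) := by
    obtain ⟨e⟩ := hF.closedDisk
    have := isCompact_iff_compactSpace.mp (isCompact_closedBall (0 : Plane) 1)
    exact isCompact_iff_compactSpace.mpr e.symm.compactSpace
  have hmem : ∀ P : attractor hF.hyperbolic.glued Δ, ∀ n : ℤ, (hF.hyperbolic.glued ^ n) P ∈ Δ :=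
    fun P => zpow_mem_of_mem_iInter_image ((image_mono subset_closure).trans hcl) P.2
  have hiff : ∀ (p : admissible hF.hyperbolic.glued g Δ) (P : attractor hF.hyperbolic.glued Δ),
      IsItinerary hF.hyperbolic.glued g P p ↔ P = codingMap hF.hyperbolic.glued g Δ p := by
    intro p P
    have hc : IsItinerary hF.hyperbolic.glued g (codingMap hF.hyperbolic.glued g Δ p) p :=
      p.2.choose_spec.2
    constructor
    · intro hP
      exact Subtype.ext (hF.hyperbolic.eq_of_isItinerary (hcpt.isBounded.subset subset_closure)
        (hmem P) (hmem _) hP hc)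
    · rintro rfl
      exact hc
  refine ⟨hiff, fun P => ?_, ?_⟩
  · choose p hp using fun n : ℤ => exists_mem_halfPlane g ((hF.hyperbolic.glued ^ n) P)
    exact ⟨⟨p, P, P.2, hp⟩, ((hiff ⟨p, P, P.2, hp⟩ P).mp hp).symm⟩
  · have hcompact : IsCompact (attractor hF.hyperbolic.glued Δ) := by
      rw [attractor, iInter_image_eq_iInter_image_closure hcl]
      have himage : ∀ n : ℕ, IsCompact ((hF.hyperbolic.glued ^ n : Equiv.Perm Plane) '' closure Δ) :=
        fun n => hcpt.image (by simpa using hF.hyperbolic.continuous_zpow_glued n)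
      exact (himage 0).of_isClosed_subset (isClosed_iInter fun n => (himage n).isClosed)
        (iInter_subset _ 0)
    have := isCompact_iff_compactSpace.mp hcompact
    refine continuous_of_isClosed_graph_of_compactSpace ?_
    simp only [← hiff, IsItinerary, ofPred_forall]
    refine isClosed_iInter fun n => ?_
    have hsplit : {q : admissible hF.hyperbolic.glued g Δ × attractor hF.hyperbolic.glued Δ |
        (hF.hyperbolic.glued ^ n) q.2 ∈ halfPlane g (q.1.1 n)} =
        ⋃ s : Bool, {q | q.1.1 n = s} ∩ {q | (hF.hyperbolic.glued ^ n) q.2 ∈ halfPlane g s} := by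
      ext q
      simp
    rw [hsplit]
    have hcn := hF.hyperbolic.continuous_zpow_glued n
    refine isClosed_iUnion_of_finite fun s => IsClosed.inter ?_ ?_
    · exact isClosed_eq ((continuous_apply n).comp (continuous_subtype_val.comp continuous_fst))
        continuous_const
    · exact (isClosed_halfPlane hF.hyperbolic.isDivider.1 s).preimage
        (hcn.comp (continuous_subtype_val.comp continuous_snd))
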